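/- **Theorem (Bernstein's theorem).** Let $u:\mathbb R^2\to\mathbb R$ be an entire solution of the minimal surface equation, i.e. $u$ is a $C^2$ function on all of $\mathbb R^2$ satisfying $$\operatorname{div}\left(\frac{\nabla u}{\sqrt{1+|\nabla u|^2}}\right)=0$$ at every point of $\mathbb R^2$. Then $u$ is an affine function. -/

import Mathlib

/-- The divergence `∑ i, ∂Fᵢ/∂xᵢ` of a vector field `F` on `ℝⁿ`. -/
noncomputable def vectorFieldDiv {n : ℕ}
    (F : EuclideanSpace ℝ (Fin n) → EuclideanSpace ℝ (Fin n))
    (x : EuclideanSpace ℝ (Fin n)) : ℝ :=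
  ∑ i : Fin n, (fderiv ℝ F x (EuclideanSpace.single i 1)) i

/-- `u` is an entire (classical) solution of the minimal surface equation on `ℝⁿ`: it is `C²` on
all of `ℝⁿ` and satisfies `div (∇u / √(1 + |∇u|²)) = 0` at every point. -/
structure IsEntireMinimalSurfaceSolution {n : ℕ}
    (u : EuclideanSpace ℝ (Fin n) → ℝ) : Prop where
  contDiff : ContDiff ℝ 2 u
  div_eq_zero : ∀ x : EuclideanSpace ℝ (Fin n),
    vectorFieldDiv (fun y => (Real.sqrt (1 + ‖gradient u y‖ ^ 2))⁻¹ • gradient u y) x = 0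

/-! Write `p`, `q` for the partial derivatives of `u` and W = √(1 + p² + q²). The symmetric matrix
with entries (1 + p²)/W, pq/W, (1 + q²)/W is positive definite of determinant one, and the equation
makes its rows closed, so it is the Jacobian of a plane map `Φ`. Such a Jacobian is constant
(`jacobian_const_of_symm_det_one`): the Lewy transform ζ = z + Φ(z) is a homeomorphism of the plane,
and the conjugate of z − Φ(z) is an entire function of ζ with bounded derivative. Liouville makes
that derivative constant, and it determines the matrix. The trace W + 1/W then fixes W since W ≥ 1;
hence p² and q², and finally `p` and `q`, are constant. -/

/-- The real-linear endomorphism of `ℂ = ℝ²` with symmetric matrix `!![a, b; b, c]`. -/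
noncomputable def symmCLM (a b c : ℝ) : ℂ →L[ℝ] ℂ :=
  a • Complex.reCLM.smulRight (1 : ℂ) +
    b • (Complex.imCLM.smulRight (1 : ℂ) + Complex.reCLM.smulRight Complex.I) +
    c • Complex.imCLM.smulRight Complex.I

theorem symmCLM_apply (a b c : ℝ) (h : ℂ) :
    symmCLM a b c h = ⟨a * h.re + b * h.im, b * h.re + c * h.im⟩ := by
  apply Complex.ext <;> simp [symmCLM]

theorem continuousLinearMap_complex_apply (L : ℂ →L[ℝ] ℝ) (h : ℂ) :
    L h = h.re * L 1 + h.im * L Complex.I := by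
  conv_lhs => rw [show h = h.re • (1 : ℂ) + h.im • Complex.I by apply Complex.ext <;> simp]
  simp only [map_add, map_smul, smul_eq_mul]

/-- A continuously differentiable field of symmetric matrices with closed rows is a Jacobian. -/
theorem exists_hasFDerivAt_symmCLM {a b c : ℂ → ℝ} (ha : Differentiable ℝ a)
    (hb : Differentiable ℝ b) (hc : Differentiable ℝ c)
    (hab : ∀ z, fderiv ℝ a z Complex.I = fderiv ℝ b z 1)
    (hbc : ∀ z, fderiv ℝ b z Complex.I = fderiv ℝ c z 1) :
    ∃ Φ : ℂ → ℂ, ∀ z, HasFDerivAt Φ (symmCLM (a z) (b z) (c z)) z := by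
  have hω : ∀ z, HasFDerivAt (fun z => symmCLM (a z) (b z) (c z))
      ((fderiv ℝ a z).smulRight (Complex.reCLM.smulRight (1 : ℂ)) +
        (fderiv ℝ b z).smulRight
          (Complex.imCLM.smulRight (1 : ℂ) + Complex.reCLM.smulRight Complex.I) +
        (fderiv ℝ c z).smulRight (Complex.imCLM.smulRight Complex.I)) z := fun z =>
    (((ha z).hasFDerivAt.smul_const _).add ((hb z).hasFDerivAt.smul_const _)).add
      ((hc z).hasFDerivAt.smul_const (Complex.imCLM.smulRight Complex.I))
  obtain ⟨Φ, hΦ⟩ := convex_univ.exists_forall_hasFDerivAt_of_fderiv_symmetric isOpen_univ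
    (ω := fun z => symmCLM (a z) (b z) (c z))
    (fun z _ => (hω z).differentiableAt.differentiableWithinAt) (by
      intro z _ x y
      rw [(hω z).fderiv]
      apply Complex.ext <;>
      · simp [continuousLinearMap_complex_apply (fderiv ℝ _ z) x,
          continuousLinearMap_complex_apply (fderiv ℝ _ z) y, hab, hbc]
        ring)
  exact ⟨Φ, fun z => hΦ z trivial⟩

theorem symm_form_nonneg {a b c : ℝ} (ha : 0 < a) (hdet : a * c - b ^ 2 = 1) (x y : ℝ) :
    0 ≤ a * x ^ 2 + 2 * b * x * y + c * y ^ 2 := by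
  have h : 0 ≤ a * (a * x ^ 2 + 2 * b * x * y + c * y ^ 2) := by
    have : a * (a * x ^ 2 + 2 * b * x * y + c * y ^ 2) = (a * x + b * y) ^ 2 + y ^ 2 := by
      linear_combination y ^ 2 * hdet
    rw [this]; positivity
  exact nonneg_of_mul_nonneg_right h ha

theorem two_le_trace {a b c : ℝ} (ha : 0 < a) (hdet : a * c - b ^ 2 = 1) : 2 ≤ a + c := by
  have hc : 0 < c := by
    by_contra! h
    nlinarith [mul_nonneg ha.le (neg_nonneg.2 h), sq_nonneg b]
  nlinarith [sq_nonneg (a - c), sq_nonneg b]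

/-- Along the segment from `x` to `x + h`, the derivative of ⟨h, Φ⟩ is the quadratic form of the
Jacobian at `h`. -/
theorem monotone_of_hasFDerivAt_symmCLM {a b c : ℂ → ℝ} {Φ : ℂ → ℂ}
    (hΦ : ∀ z, HasFDerivAt Φ (symmCLM (a z) (b z) (c z)) z)
    (ha : ∀ z, 0 < a z) (hdet : ∀ z, a z * c z - b z ^ 2 = 1) (x h : ℂ) :
    0 ≤ h.re * (Φ (x + h) - Φ x).re + h.im * (Φ (x + h) - Φ x).im := by
  set g : ℝ → ℝ := fun t => h.re * (Φ (x + t • h)).re + h.im * (Φ (x + t • h)).im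
  have hg : ∀ t, HasDerivAt g (a (x + t • h) * h.re ^ 2 + 2 * b (x + t • h) * h.re * h.im
      + c (x + t • h) * h.im ^ 2) t := by
    intro t
    have h1 : HasDerivAt (fun t : ℝ => x + t • h) h t := by
      simpa using ((hasDerivAt_id t).smul_const h).const_add x
    have h2 := (hΦ (x + t • h)).comp_hasDerivAt t h1
    have h3 := (Complex.reCLM.hasFDerivAt.comp_hasDerivAt t h2).const_mul h.re
    have h4 := (Complex.imCLM.hasFDerivAt.comp_hasDerivAt t h2).const_mul h.im
    refine (h3.add h4).congr_deriv ?_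
    simp only [symmCLM_apply, Complex.reCLM_apply, Complex.imCLM_apply]
    ring
  have hmono : Monotone g := monotone_of_deriv_nonneg (fun t => (hg t).differentiableAt)
    fun t => by rw [(hg t).deriv]; exact symm_form_nonneg (ha _) (hdet _) _ _
  have := hmono zero_le_one
  simp only [g, zero_smul, one_smul, add_zero] at this
  simp only [Complex.sub_re, Complex.sub_im]
  linarith

/-- The Lewy transform is expanding. -/
theorem antilipschitzWith_id_add {a b c : ℂ → ℝ} {Φ : ℂ → ℂ}
    (hΦ : ∀ z, HasFDerivAt Φ (symmCLM (a z) (b z) (c z)) z)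
    (ha : ∀ z, 0 < a z) (hdet : ∀ z, a z * c z - b z ^ 2 = 1) :
    AntilipschitzWith 1 (fun z => z + Φ z) := by
  refine AntilipschitzWith.of_le_mul_dist fun x y => ?_
  have hm := monotone_of_hasFDerivAt_symmCLM hΦ ha hdet y (x - y)
  rw [add_sub_cancel] at hm
  rw [NNReal.coe_one, one_mul, dist_eq_norm, dist_eq_norm, ← sq_le_sq₀ (norm_nonneg _)
    (norm_nonneg _), Complex.sq_norm, Complex.sq_norm, Complex.normSq_apply, Complex.normSq_apply]
  simp only [Complex.sub_re, Complex.sub_im, Complex.add_re, Complex.add_im] at hm ⊢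
  -- Expand |Δz + ΔΦ|² = |Δz|² + 2⟨Δz, ΔΦ⟩ + |ΔΦ|²; the cross term is `hm`.
  nlinarith [sq_nonneg ((Φ x).re - (Φ y).re), sq_nonneg ((Φ x).im - (Φ y).im)]

theorem exists_equiv_id_add_symmCLM {a b c : ℝ} (ha : 0 < a) (hdet : a * c - b ^ 2 = 1) :
    ∃ e : ℂ ≃L[ℝ] ℂ, (e : ℂ →L[ℝ] ℂ) = ContinuousLinearMap.id ℝ ℂ + symmCLM a b c := by
  have hinj : Function.Injective (ContinuousLinearMap.id ℝ ℂ + symmCLM a b c).toLinearMap := by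
    rw [injective_iff_map_eq_zero]
    intro h hh
    have hre := congrArg Complex.re hh
    have him := congrArg Complex.im hh
    simp [symmCLM_apply] at hre him
    have := symm_form_nonneg ha hdet h.re h.im
    have h0 : h.re ^ 2 + h.im ^ 2 ≤ 0 := by
      linear_combination this + h.re * hre + h.im * him
    apply Complex.ext <;> simp <;> nlinarith [sq_nonneg h.re, sq_nonneg h.im]
  exact ⟨(LinearEquiv.ofInjectiveEndo _ hinj).toContinuousLinearEquiv, rfl⟩

/-! ### The dilatation and Jörgens' theorem -/

/-- The complex dilatation of the Lewy transform. -/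
noncomputable def lewyDilatation (a b c : ℝ) : ℂ := ⟨(c - a) / (a + c + 2), 2 * b / (a + c + 2)⟩

/-- With A the matrix, det A = 1 makes (I − A)(I + A)⁻¹ a multiple of A⁻¹ − A, which is symmetric
and traceless. Such a map is conjugation followed by a complex multiplication, so its conjugate is
complex linear. -/
theorem conj_sub_symmCLM {a b c : ℝ} (ha : 0 < a) (hdet : a * c - b ^ 2 = 1) (h : ℂ) :
    (starRingEnd ℂ) (h - symmCLM a b c h) = lewyDilatation a b c * (h + symmCLM a b c h) := by
  have := two_le_trace ha hdet
  have h0 : a + c + 2 ≠ 0 := by positivity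
  apply Complex.ext
  · simp [symmCLM_apply, lewyDilatation]
    field_simp
    linear_combination (-2 * h.re) * hdet
  · simp [symmCLM_apply, lewyDilatation]
    field_simp
    linear_combination (2 * h.im) * hdet

theorem normSq_lewyDilatation {a b c : ℝ} (ha : 0 < a) (hdet : a * c - b ^ 2 = 1) :
    Complex.normSq (lewyDilatation a b c) = 1 - 4 / (a + c + 2) := by
  have := two_le_trace ha hdet
  have h0 : a + c + 2 ≠ 0 := by positivity
  simp [Complex.normSq_apply, lewyDilatation]
  field_simp
  linear_combination (-4) * hdet

/-- The modulus recovers the trace, after which the real and imaginary parts give `c - a` and `b`.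
-/
theorem eq_of_lewyDilatation_eq {a b c a' b' c' : ℝ} (ha : 0 < a) (hdet : a * c - b ^ 2 = 1)
    (ha' : 0 < a') (hdet' : a' * c' - b' ^ 2 = 1)
    (h : lewyDilatation a b c = lewyDilatation a' b' c') : a = a' ∧ b = b' ∧ c = c' := by
  have h1 := two_le_trace ha hdet
  have h2 := two_le_trace ha' hdet'
  have h0 : 0 < a + c + 2 := by positivity
  have h0' : 0 < a' + c' + 2 := by positivity
  have hn := congrArg Complex.normSq h
  rw [normSq_lewyDilatation ha hdet, normSq_lewyDilatation ha' hdet'] at hn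
  have ht : a + c + 2 = a' + c' + 2 := by
    field_simp at hn
    linarith
  have hre := congrArg Complex.re h
  have him := congrArg Complex.im h
  simp only [lewyDilatation] at hre him
  rw [ht] at hre him
  field_simp at hre him
  refine ⟨?_, ?_, ?_⟩ <;> linarith

/-- A `C¹` map of the plane whose Jacobian is everywhere symmetric, positive definite and of
determinant one has constant Jacobian (Jörgens). -/
theorem jacobian_const_of_symm_det_one {a b c : ℂ → ℝ} {Φ : ℂ → ℂ}
    (hΦ : ∀ z, HasFDerivAt Φ (symmCLM (a z) (b z) (c z)) z)
    (hac : Continuous a) (hbc : Continuous b) (hcc : Continuous c)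
    (ha : ∀ z, 0 < a z) (hdet : ∀ z, a z * c z - b z ^ 2 = 1) (x y : ℂ) :
    a x = a y ∧ b x = b y ∧ c x = c y := by
  choose e he using fun z => exists_equiv_id_add_symmCLM (ha z) (hdet z)
  set T : ℂ → ℂ := fun z => z + Φ z with hT
  have hanti : AntilipschitzWith 1 T := antilipschitzWith_id_add hΦ ha hdet
  have hTd : ∀ z, HasFDerivAt T (e z : ℂ →L[ℝ] ℂ) z := fun z => by
    rw [he]; exact (hasFDerivAt_id z).add (hΦ z)
  have hcont : Continuous fun z => (e z : ℂ →L[ℝ] ℂ) := by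
    simp only [he, symmCLM]; fun_prop
  have hTs : ∀ z, HasStrictFDerivAt T (e z : ℂ →L[ℝ] ℂ) z := fun z =>
    hasStrictFDerivAt_of_hasFDerivAt_of_continuousAt (.of_forall hTd) hcont.continuousAt
  have hopen : IsOpenMap T := isOpenMap_of_hasStrictFDerivAt_equiv hTs
  have hTc : Continuous T := continuous_iff_continuousAt.2 fun z => (hTd z).continuousAt
  -- An expanding continuous map is proper, so the range of `T` is closed as well as open.
  have hclosed : IsClosed (Set.range T) :=
    (isProperMap_iff_tendsto_cocompact.2 ⟨hTc, by
      simpa only [Metric.cobounded_eq_cocompact] using hanti.tendsto_cobounded⟩).isClosedMap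
      |>.isClosed_range
  have hsurj : Function.Surjective T := Set.range_eq_univ.1
    (IsClopen.eq_univ ⟨hclosed, hopen.isOpen_range⟩ (Set.range_nonempty T))
  obtain ⟨S, hS⟩ := hsurj.hasRightInverse
  have hSc : Continuous S := (hanti.to_rightInverse hS).continuous
  have hSd : ∀ ζ, HasFDerivAt S ((e (S ζ)).symm : ℂ →L[ℝ] ℂ) ζ := fun ζ =>
    (hTd (S ζ)).of_local_left_inverse hSc.continuousAt (.of_forall hS)
  set w : ℂ → ℂ := fun ζ => (starRingEnd ℂ) (S ζ - Φ (S ζ))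
  set μ : ℂ → ℂ := fun z => lewyDilatation (a z) (b z) (c z)
  have hw : ∀ ζ, HasDerivAt w (μ (S ζ)) ζ := by
    intro ζ
    have h1 := Complex.conjCLE.toContinuousLinearMap.hasFDerivAt.comp ζ
      ((hSd ζ).sub ((hΦ (S ζ)).comp ζ (hSd ζ)))
    -- The real derivative of `w` is multiplication by `μ (S ζ)`, so `w` is holomorphic.
    refine hasFDerivAt_of_restrictScalars ℝ h1 ?_
    refine ContinuousLinearMap.ext fun k => ?_
    obtain ⟨h, rfl⟩ := (e (S ζ)).surjective k
    have hk : e (S ζ) h = h + symmCLM (a (S ζ)) (b (S ζ)) (c (S ζ)) h :=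
      DFunLike.congr_fun (he (S ζ)) h
    have := conj_sub_symmCLM (ha (S ζ)) (hdet (S ζ)) h
    simp only [ContinuousLinearMap.coe_restrictScalars', ContinuousLinearMap.toSpanSingleton_apply,
      smul_eq_mul, ContinuousLinearMap.comp_apply, sub_apply,
      ContinuousLinearEquiv.coe_coe, ContinuousLinearEquiv.symm_apply_apply, Complex.conjCLE_apply]
    rw [this, hk, mul_comm]
  have hwd : Differentiable ℂ w := fun ζ => (hw ζ).differentiableAt
  have hderiv : deriv w = fun ζ => μ (S ζ) := funext fun ζ => (hw ζ).deriv
  have hbound : Bornology.IsBounded (Set.range (deriv w)) := by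
    rw [hderiv]
    refine (Metric.isBounded_closedBall (x := (0 : ℂ)) (r := 1)).subset ?_
    rintro _ ⟨ζ, rfl⟩
    have htr := two_le_trace (ha (S ζ)) (hdet (S ζ))
    have hn := normSq_lewyDilatation (ha (S ζ)) (hdet (S ζ))
    rw [mem_closedBall_zero_iff, ← sq_le_one_iff₀ (norm_nonneg _), Complex.sq_norm, hn]
    have : 0 ≤ 4 / (a (S ζ) + c (S ζ) + 2) := by positivity
    linarith
  -- Liouville, applied to `deriv w`.
  have hconst := (hwd.contDiff (n := 2)).differentiable_deriv_two.apply_eq_apply_of_bounded hbound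
    (T x) (T y)
  have hST : ∀ z, S (T z) = z := fun z => hanti.injective (hS (T z))
  simp only [hderiv, hST] at hconst
  exact eq_of_lewyDilatation_eq (ha x) (hdet x) (ha y) (hdet y) hconst

/-! ### From the minimal surface equation to a constant gradient -/

theorem constant_of_sq_constant {f : ℂ → ℝ} (hf : Differentiable ℝ f)
    (h : ∀ x y, f x ^ 2 = f y ^ 2) (x y : ℂ) : f x = f y := by
  by_cases hx : f x = 0
  · have := h x y
    rw [hx] at this
    rw [hx, eq_comm, ← sq_eq_zero_iff, ← this, sq, zero_mul]
  · refine is_const_of_fderiv_eq_zero hf (fun z => ?_) x y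
    have hz : f z ≠ 0 := fun h0 => hx <| sq_eq_zero_iff.1 <| by rw [h x z, h0, sq, zero_mul]
    have h1 : HasFDerivAt (fun z => f z ^ 2) ((2 * f z) • fderiv ℝ f z) z := by
      simpa using (hf z).hasFDerivAt.pow 2
    have h2 : HasFDerivAt (fun z => f z ^ 2) (0 : ℂ →L[ℝ] ℝ) z := by
      rw [show (fun z => f z ^ 2) = fun _ => f x ^ 2 from funext fun z => h z x]
      exact hasFDerivAt_const _ _
    exact (smul_eq_zero.1 (h1.unique h2)).resolve_left (mul_ne_zero two_ne_zero hz)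

theorem eq_of_add_inv_eq {s t : ℝ} (hs : 1 ≤ s) (ht : 1 ≤ t) (h : s + s⁻¹ = t + t⁻¹) : s = t := by
  have hs0 : s ≠ 0 := by positivity
  have ht0 : t ≠ 0 := by positivity
  have : (s - t) * (s * t - 1) = 0 := by
    field_simp at h
    linear_combination h
  rcases mul_eq_zero.1 this with h | h
  · linarith
  · nlinarith

/-- The two components of the gradient of an entire solution of the minimal surface equation
are constant. -/
theorem gradient_const_of_minimal_surface_eq {p q : ℂ → ℝ} (hp : ContDiff ℝ 1 p)
    (hq : ContDiff ℝ 1 q) (hpq : ∀ z, fderiv ℝ p z Complex.I = fderiv ℝ q z 1)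
    (hdiv : ∀ z, fderiv ℝ (fun z => (√(1 + (p z ^ 2 + q z ^ 2)))⁻¹ * p z) z 1 +
      fderiv ℝ (fun z => (√(1 + (p z ^ 2 + q z ^ 2)))⁻¹ * q z) z Complex.I = 0) (x y : ℂ) :
    p x = p y ∧ q x = q y := by
  set V : ℂ → ℝ := fun z => (√(1 + (p z ^ 2 + q z ^ 2)))⁻¹ with hV
  have hpd : ∀ z, HasFDerivAt p (fderiv ℝ p z) z := fun z =>
    (hp.differentiable one_ne_zero z).hasFDerivAt
  have hqd : ∀ z, HasFDerivAt q (fderiv ℝ q z) z := fun z =>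
    (hq.differentiable one_ne_zero z).hasFDerivAt
  have hpos : ∀ z, 0 < 1 + (p z ^ 2 + q z ^ 2) := fun z => by positivity
  have hV0 : ∀ z, 0 < V z := fun z => inv_pos.2 (Real.sqrt_pos.2 (hpos z))
  have hVsq : ∀ z, V z ^ 2 * (1 + p z ^ 2 + q z ^ 2) = 1 := fun z => by
    rw [hV, inv_pow, Real.sq_sqrt (hpos z).le, add_assoc, inv_mul_cancel₀ (hpos z).ne']
  have hVd : ∀ z, HasFDerivAt V
      (-(V z ^ 3) • (p z • fderiv ℝ p z + q z • fderiv ℝ q z)) z := by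
    intro z
    have h1 := ((((hpd z).pow 2).add ((hqd z).pow 2)).const_add 1).sqrt (hpos z).ne'
    have h2 := (hasDerivAt_inv (Real.sqrt_pos.2 (hpos z)).ne').comp_hasFDerivAt z h1
    refine h2.congr_fderiv ?_
    ext v
    have hs := (Real.sqrt_pos.2 (hpos z)).ne'
    simp [hV]
    field_simp
  -- The equation in non-divergence form; closedness of both rows is a multiple of it modulo `hVsq`.
  have hdiv' : ∀ z, fderiv ℝ p z 1 * V z - p z * V z ^ 3 *
      (p z * fderiv ℝ p z 1 + q z * fderiv ℝ q z 1) + (fderiv ℝ q z Complex.I * V z -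
      q z * V z ^ 3 * (p z * fderiv ℝ q z 1 + q z * fderiv ℝ q z Complex.I)) = 0 := by
    intro z
    have h := hdiv z
    change fderiv ℝ (V * p) z 1 + fderiv ℝ (V * q) z Complex.I = 0 at h
    rw [((hVd z).mul (hpd z)).fderiv, ((hVd z).mul (hqd z)).fderiv] at h
    simp [hpq] at h
    linear_combination h
  have had : ∀ z, HasFDerivAt (fun z => (1 + p z ^ 2) * V z) _ z := fun z =>
    (((hpd z).pow 2).const_add 1).mul (hVd z)
  have hbd : ∀ z, HasFDerivAt (fun z => (p z * q z) * V z) _ z := fun z =>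
    ((hpd z).mul (hqd z)).mul (hVd z)
  have hcd : ∀ z, HasFDerivAt (fun z => (1 + q z ^ 2) * V z) _ z := fun z =>
    (((hqd z).pow 2).const_add 1).mul (hVd z)
  obtain ⟨Φ, hΦ⟩ := exists_hasFDerivAt_symmCLM (fun z => (had z).differentiableAt)
    (fun z => (hbd z).differentiableAt) (fun z => (hcd z).differentiableAt)
    (by
      intro z
      rw [(had z).fderiv, (hbd z).fderiv]
      simp [hpq]
      linear_combination (-q z) * hdiv' z - V z * (p z * fderiv ℝ q z 1 +
        q z * fderiv ℝ q z Complex.I) * hVsq z)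
    (by
      intro z
      rw [(hbd z).fderiv, (hcd z).fderiv]
      simp [hpq]
      linear_combination (p z) * hdiv' z + V z * (q z * fderiv ℝ q z 1 +
        p z * fderiv ℝ p z 1) * hVsq z)
  have hdet : ∀ z, ((1 + p z ^ 2) * V z) * ((1 + q z ^ 2) * V z) - ((p z * q z) * V z) ^ 2 = 1 :=
    fun z => by linear_combination hVsq z
  have hconst : ∀ x y, _ ∧ _ ∧ _ := jacobian_const_of_symm_det_one hΦ
    (continuous_iff_continuousAt.2 fun z => (had z).continuousAt)
    (continuous_iff_continuousAt.2 fun z => (hbd z).continuousAt)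
    (continuous_iff_continuousAt.2 fun z => (hcd z).continuousAt)
    (fun z => mul_pos (by positivity) (hV0 z)) hdet
  have hVle : ∀ z, 1 ≤ (V z)⁻¹ := fun z => by
    rw [hV, inv_inv, Real.one_le_sqrt]
    nlinarith [sq_nonneg (p z), sq_nonneg (q z)]
  -- The trace is W + 1/W, where W is the inverse of `V`.
  have hVinv : ∀ z, (1 + p z ^ 2) * V z + (1 + q z ^ 2) * V z = (V z)⁻¹ + (V z)⁻¹⁻¹ := fun z => by
    have : (V z)⁻¹ = V z * (1 + p z ^ 2 + q z ^ 2) :=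
      inv_eq_of_mul_eq_one_right (by linear_combination hVsq z)
    rw [inv_inv (V z), this]
    ring
  have hVc : ∀ x y, V x = V y := fun x y => by
    obtain ⟨h1, -, h2⟩ := hconst x y
    refine inv_injective (eq_of_add_inv_eq (hVle x) (hVle y) ?_)
    rw [← hVinv, ← hVinv, h1, h2]
  constructor
  · refine constant_of_sq_constant (hp.differentiable one_ne_zero) (fun x y => ?_) x y
    have h := (hconst x y).1
    rw [hVc x y] at h
    linarith [mul_right_cancel₀ (hV0 y).ne' h]
  · refine constant_of_sq_constant (hq.differentiable one_ne_zero) (fun x y => ?_) x y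
    have h := (hconst x y).2.2
    rw [hVc x y] at h
    linarith [mul_right_cancel₀ (hV0 y).ne' h]

/-! ### Transfer from ℂ to the Euclidean plane -/

theorem gradient_apply_euclideanSpace {n : ℕ} (u : EuclideanSpace ℝ (Fin n) → ℝ)
    (x : EuclideanSpace ℝ (Fin n)) (i : Fin n) :
    gradient u x i = fderiv ℝ u x (EuclideanSpace.single i 1) := by
  rw [← toDual_gradient, InnerProductSpace.toDual_apply_apply, EuclideanSpace.inner_single_right]
  simp

theorem mainTheorem1 (u : EuclideanSpace ℝ (Fin 2) → ℝ)
    (hu : IsEntireMinimalSurfaceSolution u) :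
    ∃ f : EuclideanSpace ℝ (Fin 2) →ᵃ[ℝ] ℝ, ∀ x : EuclideanSpace ℝ (Fin 2), u x = f x := by
  obtain ⟨hC, hdiv⟩ := hu
  have hC1 : ContDiff ℝ 1 (fderiv ℝ u) := hC.fderiv_right (by norm_num)
  have hud : Differentiable ℝ u := hC.differentiable two_ne_zero
  set e : Fin 2 → EuclideanSpace ℝ (Fin 2) := fun i => EuclideanSpace.single i 1
  set P : Fin 2 → EuclideanSpace ℝ (Fin 2) → ℝ := fun i x => fderiv ℝ u x (e i)
  have hP : ∀ i, ContDiff ℝ 1 (P i) := fun i => hC1.clm_apply contDiff_const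
  have hPd : ∀ i x v, fderiv ℝ (P i) x v = fderiv ℝ (fderiv ℝ u) x v (e i) := fun i x v => by
    have h := ((hC1.differentiable one_ne_zero x).hasFDerivAt.clm_apply (hasFDerivAt_const (e i) x))
    rw [h.fderiv]
    simp
  have hgrad : ∀ x i, gradient u x i = P i x := gradient_apply_euclideanSpace u
  have hnorm : ∀ x, ‖gradient u x‖ ^ 2 = P 0 x ^ 2 + P 1 x ^ 2 := fun x => by
    rw [EuclideanSpace.norm_sq_eq, Fin.sum_univ_two, hgrad, hgrad]
    simp
  set G : Fin 2 → EuclideanSpace ℝ (Fin 2) → ℝ :=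
    fun i x => (√(1 + (P 0 x ^ 2 + P 1 x ^ 2)))⁻¹ * P i x
  have hG : ∀ i, Differentiable ℝ (G i) := fun i => by
    have h0 := (hP 0).differentiable one_ne_zero
    have h1 := (hP 1).differentiable one_ne_zero
    have hi := (hP i).differentiable one_ne_zero
    have hpos : ∀ x, 0 < 1 + (P 0 x ^ 2 + P 1 x ^ 2) := fun x => by positivity
    exact ((((h0.pow 2).add (h1.pow 2)).const_add 1).sqrt fun x => (hpos x).ne').inv
      (fun x => (Real.sqrt_pos.2 (hpos x)).ne') |>.mul hi
  have hdivG : ∀ x, fderiv ℝ (G 0) x (e 0) + fderiv ℝ (G 1) x (e 1) = 0 := fun x => by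
    have h := hdiv x
    have hF : HasFDerivAt (fun y => (√(1 + ‖gradient u y‖ ^ 2))⁻¹ • gradient u y)
        ((EuclideanSpace.equiv (Fin 2) ℝ).symm.toContinuousLinearMap.comp
          (ContinuousLinearMap.pi fun i => fderiv ℝ (G i) x)) x := by
      have h1 := (EuclideanSpace.equiv (Fin 2) ℝ).symm.toContinuousLinearMap.hasFDerivAt.comp x
        (hasFDerivAt_pi.2 fun i => (hG i x).hasFDerivAt)
      refine h1.congr_of_eventuallyEq (.of_forall fun y => ?_)
      ext i
      simp [hnorm, hgrad, G]
    rw [vectorFieldDiv, hF.fderiv, Fin.sum_univ_two] at h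
    simpa using h
  set L : ℂ ≃L[ℝ] EuclideanSpace ℝ (Fin 2) :=
    Complex.orthonormalBasisOneI.repr.toContinuousLinearEquiv
  have hL1 : L 1 = e 0 := by
    ext i
    fin_cases i <;> simp [L, e, Complex.orthonormalBasisOneI_repr_apply]
  have hLI : L Complex.I = e 1 := by
    ext i
    fin_cases i <;> simp [L, e, Complex.orthonormalBasisOneI_repr_apply]
  have hcomp : ∀ (f : EuclideanSpace ℝ (Fin 2) → ℝ) (z v : ℂ),
      fderiv ℝ (fun z => f (L z)) z v = fderiv ℝ f (L z) (L v) := fun f z v => by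
    have := L.comp_right_fderiv (f := f) (x := z)
    exact DFunLike.congr_fun this v
  have hconst := gradient_const_of_minimal_surface_eq (p := fun z => P 0 (L z))
    (q := fun z => P 1 (L z)) ((hP 0).comp L.contDiff) ((hP 1).comp L.contDiff)
    (fun z => by
      rw [hcomp, hcomp, hL1, hLI, hPd, hPd]
      -- Equality of mixed partials, from `u` being C².
      exact (hC.contDiffAt.isSymmSndFDerivAt (by simp)).eq _ _)
    (fun z => by
      rw [hcomp (G 0), hcomp (G 1), hL1, hLI]
      exact hdivG (L z))
  have hconst' : ∀ x, fderiv ℝ u x = fderiv ℝ u 0 := fun x => by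
    obtain ⟨h0, h1⟩ := hconst (L.symm x) (L.symm 0)
    simp only [L.apply_symm_apply] at h0 h1
    refine ContinuousLinearMap.coe_injective
      ((EuclideanSpace.basisFun (Fin 2) ℝ).toBasis.ext fun i => ?_)
    fin_cases i
    · simpa using h0
    · simpa using h1
  have hd : ∀ x, HasFDerivAt (fun x => u x - fderiv ℝ u 0 x) (0 : _ →L[ℝ] ℝ) x := fun x => by
    have h := (hud x).hasFDerivAt.sub (fderiv ℝ u 0).hasFDerivAt
    rwa [hconst' x, sub_self] at h
  refine ⟨(fderiv ℝ u 0).toLinearMap.toAffineMap + AffineMap.const ℝ _ (u 0), fun x => ?_⟩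
  have h := is_const_of_fderiv_eq_zero (fun x => (hd x).differentiableAt)
    (fun x => (hd x).fderiv) x 0
  simp only [map_zero, sub_zero] at h
  change u x = fderiv ℝ u 0 x + u 0
  linarith
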